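/- Conventions. All Hilbert spaces below are real. A family $\{\psi_i\}_{i\in\mathscr I}$ in a Hilbert space is *locally complementary* with respect to a family $\{P_j\}_{j\in\Delta}$ of orthogonal projections if for every partition of $\mathscr I$ into two disjoint (possibly empty) parts $\mathscr I_1,\mathscr I_2$ there is $k\in\{1,2\}$ such that for every $j\in\Delta$ the closed linear span of $\{P_j\psi_i : i\in\mathscr I_k\}$ is the range of $P_j$. For a bounded operator $D$ and a vector $\psi$, let $r^D_\psi$ be the smallest degree of a monic polynomial $p$ with $p(D)\psi=0$, and $r^D_\psi=\infty$ if there is no such polynomial (so $r^D_0=0$). A set $\mathcal F$ *does phaseless reconstruction* in $\mathcal H$ if, for all $x,y\in\mathcal H$, $|\langle x,f\rangle|=|\langle y,f\rangle|$ for all $f\in\mathcal F$ implies $y=\pm x$. **Theorem.** Let $A$ be a strictly positive operator on a real separable Hilbert space $\mathcal H$, i.e. $A$ is bounded, self-adjoint and $\langle Ax,x\rangle>0$ for all $x\neq 0$. Assume that $A^T=U^*DU$, where $A^T$ is the adjoint of $A$, $U$ is a unitary operator from $\mathcal H$ onto $\ell^2(\mathbb N)$, and $D$ is a bounded diagonal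 operator on $\ell^2(\mathbb N)$ with the spectral decomposition $D=\sum_{j\in\Delta}\lambda_jP_j$, where the $\lambda_j$ are the distinct eigenvalues of $D$ and $P_j$ is the orthogonal projection onto the eigenspace of $\lambda_j$. Let $\{\phi_i\}_{i\in\mathscr I}$ be a family of vectors in $\mathcal H$, $\psi_i=U\phi_i$, and let $l_i=2r^D_{\psi_i}-1$ if $r^D_{\psi_i}<\infty$ and $l_i=\infty$ otherwise. If $\Psi=\{\psi_i\}_{i\in\mathscr I}$ is locally complementary with respect to $\{P_j\}_{j\in\Delta}$, then the set of vectors $$\mathcal E=\{(A^T)^l\phi_i : i\in\mathscr I,\ l\in\mathbb Z,\ 0\le l<l_i\}$$ does phaseless reconstruction in $\mathcal H$. In other words, any $f\in\mathcal H$ is uniquely determined up to a sign by its unsigned measurements $\{|\langle A^lf,\phi_i\rangle| : i\in\mathscr I,\ l\in\mathbb Z,\ 0\le l<l_i\}$. -/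

import Mathlib

/-- The real Hilbert space `ℓ²(ℕ)`. -/
abbrev RealEllTwo : Type := lp (fun _ : ℕ => ℝ) 2

section General

variable {𝕜 : Type*} [RCLike 𝕜] {E : Type*} [NormedAddCommGroup E] [InnerProductSpace 𝕜 E]

/-- `F` does phaseless reconstruction on `E`: two vectors with the same phaseless measurements
`|⟨x, f⟩|`, `f ∈ F`, agree up to a unimodular scalar (a global phase). -/
def DoesPhaselessReconstruction (𝕜 : Type*) [RCLike 𝕜] {E : Type*} [NormedAddCommGroup E]
    [InnerProductSpace 𝕜 E] (F : Set E) : Prop :=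
  ∀ x y : E, (∀ f ∈ F, ‖inner 𝕜 x f‖ = ‖inner 𝕜 y f‖) → ∃ c : 𝕜, ‖c‖ = 1 ∧ y = c • x

/-- A family `ψ` is locally complementary with respect to a family `P` of projections: for every
partition of the index set of `ψ` into two (possibly empty) parts, one of the two parts `I` has
the property that, for all `j` simultaneously, the vectors `P j (ψ i)`, `i ∈ I`, span the range
of `P j`. Ranges may have infinite dimension, and "span" means that the closed linear span is the
whole range (the usual span when the range has finite dimension). -/
def LocallyComplementary {Γ ι : Type*} (P : Γ → E →L[𝕜] E) (ψ : ι → E) : Prop :=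
  ∀ I₁ I₂ : Set ι, I₁ ∪ I₂ = Set.univ → Disjoint I₁ I₂ →
    (∀ j, (Submodule.span 𝕜 ((fun i => P j (ψ i)) '' I₁)).topologicalClosure
        = LinearMap.range (P j : E →ₗ[𝕜] E)) ∨
    (∀ j, (Submodule.span 𝕜 ((fun i => P j (ψ i)) '' I₂)).topologicalClosure
        = LinearMap.range (P j : E →ₗ[𝕜] E))

/-- The degree `r` of the `(T, x)`-annihilator: the smallest degree of a monic polynomial `p`
with `p(T) x = 0`, and `⊤` if there is no such polynomial (an infimum over the empty family). -/
noncomputable def annihilatorDegree (T : E →L[𝕜] E) (x : E) : ℕ∞ :=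
  ⨅ (p : Polynomial 𝕜) (_ : p.Monic ∧ Polynomial.aeval T p x = 0), (p.natDegree : ℕ∞)

open Classical in
/-- The number of time levels: `2 r - 1` if the degree `r` of the `(T, x)`-annihilator is finite,
infinite otherwise. For `r = 0`, that is `x = 0`, there are no time levels: the truncated
subtraction gives `0`, and no natural number is below `0`, just as none is below `-1`. -/
noncomputable def numTimeLevels (T : E →L[𝕜] E) (x : E) : ℕ∞ :=
  if annihilatorDegree T x = ⊤ then ⊤ else 2 * annihilatorDegree T x - 1

/-- The eigenspace of `T` for `μ`. -/
def eigenKer (T : E →L[𝕜] E) (μ : 𝕜) : Submodule 𝕜 E :=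
  LinearMap.ker ((T - μ • ContinuousLinearMap.id 𝕜 E : E →L[𝕜] E) : E →ₗ[𝕜] E)

theorem mem_eigenKer (T : E →L[𝕜] E) (μ : 𝕜) (x : E) : x ∈ eigenKer T μ ↔ T x = μ • x := by
  simp [eigenKer, sub_eq_zero]

instance completeSpace_eigenKer [CompleteSpace E] (T : E →L[𝕜] E) (μ : 𝕜) :
    CompleteSpace (eigenKer T μ) := by
  have h : IsClosed ((eigenKer T μ : Submodule 𝕜 E) : Set E) :=
    ContinuousLinearMap.isClosed_ker (T - μ • ContinuousLinearMap.id 𝕜 E)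
  exact h.completeSpace_coe

/-- The set `Δ` of (distinct) eigenvalues of `T`, which indexes the spectral projections. -/
def eigenvalueSet (T : E →L[𝕜] E) : Set 𝕜 := {μ | ∃ x : E, x ≠ 0 ∧ T x = μ • x}

/-- The spectral projection of `T` for the eigenvalue `μ`: the orthogonal projection onto the
eigenspace. -/
noncomputable def spectralProj [CompleteSpace E] (T : E →L[𝕜] E) (μ : eigenvalueSet T) :
    E →L[𝕜] E :=
  (eigenKer T (μ : 𝕜)).starProjection

/-- A strictly positive operator: self-adjoint, with `⟨T x, x⟩ > 0` for every `x ≠ 0`. -/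
def StrictlyPositiveOperator (T : E →L[𝕜] E) : Prop :=
  T.IsPositive ∧ ∀ x : E, x ≠ 0 → 0 < RCLike.re (inner 𝕜 (T x) x)

end General

/-- `D` is a diagonal operator on `ℓ²(ℕ)`. -/
def IsDiagonalOperator (D : RealEllTwo →L[ℝ] RealEllTwo) : Prop :=
  ∃ d : ℕ → ℝ, ∀ (x : RealEllTwo) (n : ℕ), D x n = d n * x n

/-! Conjugating by `U` turns the measurements into moments `∑ xₙ ψₙ dₙ^l` of discrete measures, with
all `dₙ > 0` by strict positivity. Equal absolute values at level `l` mean that the `l`-th moment of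
`(x - y)ψ` or of `(x + y)ψ` vanishes, and the sign may depend on `l`. The point is that for each
`ψᵢ` a single sign works for all the masses at the eigenvalues
(`inner_spectralProj_sub_or_add_eq_zero`). If the annihilator has degree `r`, at most `r`
eigenvalues matter. Among `2r - 1` levels one sign occurs `r` times, and generalized Vandermonde
matrices with positive nodes are injective by Descartes' rule. If there is no annihilator, the
product of the two moment sequences is the moment sequence of a multiplicative convolution.
Weierstrass approximation extends its vanishing to real exponents `s > 0`. Both factors are analytic
in `s`, so one is identically zero, and a second approximation recovers the masses. Local
complementarity applied to the partition of the indices by sign gives `x = y` or `x = -y`. -/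

open Filter Topology

/-! ### Descartes' rule of signs and generalized Vandermonde matrices. -/

namespace Polynomial

/-- Erasing the leading term removes one monomial and at most one sign change; a single monomial has
none. -/
theorem signVariations_lt_card_support {p : Polynomial ℝ} (hp : p ≠ 0) :
    p.signVariations < p.support.card := by
  induction h : p.support.card using Nat.strong_induction_on generalizing p with
  | _ n ih =>
    have hlt := eraseLead_support_card_lt hp
    by_cases h0 : p.eraseLead = 0
    · have h1 := signVariations_eq_eraseLead_add_ite hp
      have h2 : SignType.sign p.leadingCoeff ≠ 0 := by simpa [sign_eq_zero_iff] using hp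
      simp only [h0, leadingCoeff_zero, sign_zero, neg_zero, h2, if_false, signVariations_zero]
        at h1
      omega
    · have h1 := ih _ (h ▸ hlt) h0 rfl
      have h2 := signVariations_le_eraseLead_succ p
      omega

theorem eq_zero_of_card_support_le_card_pos_roots {p : Polynomial ℝ} (S : Finset ℝ)
    (hpos : ∀ x ∈ S, 0 < x) (hroot : ∀ x ∈ S, p.eval x = 0) (hcard : p.support.card ≤ S.card) :
    p = 0 := by
  by_contra hp
  have h1 := signVariations_lt_card_support hp
  have h2 := roots_countP_pos_le_signVariations p
  have h3 : S.val ≤ p.roots.filter (0 < ·) := by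
    rw [Multiset.le_iff_subset S.nodup]
    intro x hx
    rw [Multiset.mem_filter, mem_roots hp]
    exact ⟨hroot x hx, hpos x hx⟩
  have h4 := Multiset.card_le_card h3
  rw [← Multiset.countP_eq_card_filter] at h4
  have h5 : Multiset.card S.val = S.card := rfl
  omega

end Polynomial

/-- Injectivity of generalized Vandermonde matrices with positive nodes. -/
theorem eq_zero_of_sum_mul_pow_eq_zero (S : Finset ℝ) (hpos : ∀ x ∈ S, 0 < x) (L : Finset ℕ)
    (hcard : S.card ≤ L.card) (c : ℝ → ℝ) (h : ∀ l ∈ L, ∑ x ∈ S, c x * x ^ l = 0) :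
    ∀ x ∈ S, c x = 0 := by
  obtain ⟨L', hL', hc⟩ := Finset.exists_subset_card_eq hcard
  let e : S ≃ L' := Finset.equivOfCardEq hc.symm
  let M : Matrix S S ℝ := Matrix.of fun i j => (j : ℝ) ^ (e i : ℕ)
  -- A left kernel vector is the coefficient list of a polynomial with exponents in `L'` that
  -- vanishes on `S`: too many positive roots for its number of terms.
  have hdet : M.det ≠ 0 := by
    intro h0
    obtain ⟨v, hv, hvM⟩ := Matrix.exists_vecMul_eq_zero_iff.mpr h0
    let p : Polynomial ℝ := ∑ i, Polynomial.monomial (e i : ℕ) (v i)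
    have hcoeff : ∀ i, p.coeff (e i) = v i := by
      intro i
      simp only [p, Polynomial.finsetSum_coeff, Polynomial.coeff_monomial]
      rw [Finset.sum_eq_single i] <;> simp +contextual
    have hsupp : p.support ⊆ L' := by
      intro l hl
      by_contra hlL
      rw [Polynomial.mem_support_iff] at hl
      apply hl
      simp only [p, Polynomial.finsetSum_coeff, Polynomial.coeff_monomial]
      refine Finset.sum_eq_zero fun i _ => if_neg ?_
      rintro rfl
      exact hlL (e i).2
    have hp : p = 0 := by
      refine Polynomial.eq_zero_of_card_support_le_card_pos_roots S hpos (fun x hx => ?_)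
        ((Finset.card_le_card hsupp).trans hc.le)
      have := congrFun hvM ⟨x, hx⟩
      simpa [p, Polynomial.eval_finsetSum, Matrix.vecMul, dotProduct, M] using this
    apply hv
    ext i
    rw [← hcoeff i, hp]
    simp
  have hker : M.mulVec (fun x => c x) = 0 := by
    ext i
    have := h _ (hL' (e i).2)
    rw [← Finset.sum_coe_sort] at this
    simpa [M, Matrix.mulVec, dotProduct, mul_comm] using this
  have := Matrix.eq_zero_of_mulVec_eq_zero hdet hker
  intro x hx
  exact congrFun this ⟨x, hx⟩

/-! ### Moments of discrete signed measures on a bounded interval. -/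

section DiscreteMoments

variable {ι κ : Type*} {c : ι → ℝ} {d : ι → ℝ} {M : ℝ}

theorem summable_mul_of_abs_le (hc : Summable c) {g : ι → ℝ} {B : ℝ} (hg : ∀ i, |g i| ≤ B) :
    Summable fun i => c i * g i := by
  refine Summable.of_norm_bounded (g := fun i => |c i| * B) (hc.abs.mul_right B) fun i => ?_
  rw [Real.norm_eq_abs, abs_mul]
  exact mul_le_mul_of_nonneg_left (hg i) (abs_nonneg _)

theorem summable_mul_comp (hc : Summable c) (hd : ∀ i, d i ∈ Set.Icc 0 M) {h : ℝ → ℝ}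
    (hh : ContinuousOn h (Set.Icc 0 M)) : Summable fun i => c i * h (d i) := by
  obtain ⟨B, hB⟩ := isCompact_Icc.exists_bound_of_continuousOn hh
  exact summable_mul_of_abs_le hc fun i => hB _ (hd i)

theorem tsum_mul_comp_eq_zero_of_moments (hc : Summable c) (hd : ∀ i, d i ∈ Set.Icc 0 M)
    (hmom : ∀ l : ℕ, ∑' i, c i * d i ^ l = 0) {h : ℝ → ℝ}
    (hh : ContinuousOn h (Set.Icc 0 M)) : ∑' i, c i * h (d i) = 0 := by
  have hpow (l : ℕ) : Summable fun i => c i * d i ^ l :=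
    summable_mul_comp hc hd (h := fun x => x ^ l) (by fun_prop)
  have hpoly (p : Polynomial ℝ) : HasSum (fun i => c i * p.eval (d i)) 0 := by
    have h1 : HasSum (fun i => ∑ l ∈ p.support, p.coeff l * (c i * d i ^ l))
        (∑ l ∈ p.support, p.coeff l * 0) :=
      hasSum_sum fun l _ => ((hmom l) ▸ (hpow l).hasSum).mul_left _
    simp only [mul_zero, Finset.sum_const_zero] at h1
    convert h1 using 2 with i
    rw [Polynomial.eval_eq_sum, Polynomial.sum, Finset.mul_sum]
    exact Finset.sum_congr rfl fun l _ => by ring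
  -- Weierstrass: polynomials integrate to zero, so an `ε`-approximation of `h` leaves only the
  -- error.
  have key : ∀ ε > 0, |∑' i, c i * h (d i)| ≤ ε * ∑' i, |c i| := by
    intro ε hε
    obtain ⟨p, hp⟩ := exists_polynomial_near_of_continuousOn 0 M h hh ε hε
    have h1 := (summable_mul_comp hc hd hh).hasSum.sub (hpoly p)
    rw [sub_zero] at h1
    rw [← h1.tsum_eq, ← Real.norm_eq_abs]
    refine tsum_of_norm_bounded (hc.abs.hasSum.mul_left ε) fun i => ?_
    rw [← mul_sub, Real.norm_eq_abs, abs_mul, mul_comm, abs_sub_comm]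
    exact mul_le_mul_of_nonneg_right (hp _ (hd i)).le (abs_nonneg _)
  have hlim : Tendsto (fun ε : ℝ => ε * ∑' i, |c i|) (𝓝[>] 0) (𝓝 0) := by
    have : Tendsto (fun ε : ℝ => ε * ∑' i, |c i|) (𝓝 0) (𝓝 (0 * ∑' i, |c i|)) :=
      tendsto_id.mul_const _
    rw [zero_mul] at this
    exact this.mono_left nhdsWithin_le_nhds
  have := ge_of_tendsto hlim (eventually_nhdsWithin_of_forall key)
  exact abs_nonpos_iff.mp this

open Classical in
theorem tsum_ite_eq_zero_of_moments (hc : Summable c) (hd : ∀ i, d i ∈ Set.Icc 0 M)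
    (hmom : ∀ l : ℕ, ∑' i, c i * d i ^ l = 0) (μ : ℝ) :
    ∑' i, (if d i = μ then c i else 0) = 0 := by
  -- Tents shrinking to the indicator of `{μ}`, with values in `[0, 1]`, so that `|c|` dominates.
  let h : ℕ → ℝ → ℝ := fun n x => max 0 (1 - n * |x - μ|)
  have hz (n : ℕ) : ∑' i, c i * h n (d i) = 0 :=
    tsum_mul_comp_eq_zero_of_moments hc hd hmom (by fun_prop)
  have hlim : Tendsto (fun n => ∑' i, c i * h n (d i)) atTop
      (𝓝 (∑' i, (if d i = μ then c i else 0))) := by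
    refine tendsto_tsum_of_dominated_convergence hc.abs (fun i => ?_)
      (Eventually.of_forall fun n i => ?_)
    · split_ifs with hi
      · simp [h, hi]
      · have hpos : 0 < |d i - μ| := abs_pos.mpr (sub_ne_zero.mpr hi)
        refine tendsto_const_nhds.congr' ?_
        obtain ⟨N, hN⟩ := exists_nat_gt (1 / |d i - μ|)
        filter_upwards [eventually_ge_atTop N] with n hn
        have h1 : 1 < n * |d i - μ| := by
          rw [← div_lt_iff₀ hpos]
          exact hN.trans_le (by exact_mod_cast hn)
        simp only [h]
        rw [max_eq_left (by linarith), mul_zero]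
    · rw [Real.norm_eq_abs, abs_mul]
      refine mul_le_of_le_one_right (abs_nonneg _) ?_
      rw [abs_of_nonneg (le_max_left _ _)]
      refine max_le zero_le_one ?_
      have : 0 ≤ n * |d i - μ| := by positivity
      linarith
  simp only [hz] at hlim
  exact tendsto_nhds_unique hlim tendsto_const_nhds

theorem analyticAt_tsum_mul_rpow (hc : Summable c) (hd : ∀ i, d i ∈ Set.Ioc 0 M) {t : ℝ}
    (ht : 0 < t) : AnalyticAt ℝ (fun s : ℝ => ∑' i, c i * d i ^ s) t := by
  -- Bounding the real part on both sides gives the uniform majorant `|c i| * (max 1 M) ^ (t + 1)`;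
  -- the `max` makes the power monotone in the exponent.
  have hU : IsOpen {z : ℂ | 0 < z.re ∧ z.re < t + 1} :=
    (isOpen_lt continuous_const Complex.continuous_re).inter
      (isOpen_lt Complex.continuous_re continuous_const)
  have hne (i : ι) : (d i : ℂ) ≠ 0 := by exact_mod_cast (hd i).1.ne'
  have hdiff : DifferentiableOn ℂ (fun z : ℂ => ∑' i, (c i : ℂ) * (d i : ℂ) ^ z)
      {z : ℂ | 0 < z.re ∧ z.re < t + 1} := by
    refine Complex.differentiableOn_tsum_of_summable_norm
      (u := fun i => |c i| * (max 1 M) ^ (t + 1)) (hc.abs.mul_right _) (fun i => ?_) hU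
      fun i w hw => ?_
    · intro z _
      exact ((differentiableAt_id.const_cpow (Or.inl (hne i))).const_mul _).differentiableWithinAt
    · rw [norm_mul, Complex.norm_real, Real.norm_eq_abs,
        Complex.norm_cpow_eq_rpow_re_of_pos (hd i).1]
      refine mul_le_mul_of_nonneg_left ?_ (abs_nonneg _)
      calc d i ^ w.re ≤ (max 1 M) ^ w.re :=
            Real.rpow_le_rpow (hd i).1.le ((hd i).2.trans (le_max_right _ _)) hw.1.le
        _ ≤ _ := Real.rpow_le_rpow_of_exponent_le (le_max_left _ _) hw.2.le
  have h1 : AnalyticAt ℂ (fun z : ℂ => ∑' i, (c i : ℂ) * (d i : ℂ) ^ z) (t : ℂ) :=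
    hdiff.analyticAt (hU.mem_nhds ⟨by simpa using ht, by simp⟩)
  have h2 : AnalyticAt ℝ (fun s : ℝ => ∑' i, (c i : ℂ) * (d i : ℂ) ^ (s : ℂ)) t :=
    (h1.restrictScalars (𝕜 := ℝ)).comp (Complex.ofRealCLM.analyticAt t)
  have h3 := (Complex.reCLM.analyticAt _).comp h2
  convert h3 using 1
  ext s
  have : ∑' i, (c i : ℂ) * (d i : ℂ) ^ (s : ℂ) = ((∑' i, c i * d i ^ s : ℝ) : ℂ) := by
    rw [Complex.ofReal_tsum]
    refine tsum_congr fun i => ?_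
    rw [Complex.ofReal_mul, Complex.ofReal_cpow (hd i).1.le]
  simp [this]

/-- If the products of the corresponding moments of two discrete measures on `(0, M]` vanish,
then all moments of positive order of one of the two measures vanish. -/
theorem moments_eq_zero_or_of_mul_eq_zero {c' : κ → ℝ} {d' : κ → ℝ}
    (hc : Summable c) (hd : ∀ i, d i ∈ Set.Ioc 0 M)
    (hc' : Summable c') (hd' : ∀ i, d' i ∈ Set.Ioc 0 M)
    (hmom : ∀ l : ℕ, (∑' i, c i * d i ^ l) * ∑' i, c' i * d' i ^ l = 0) :
    (∀ l : ℕ, 0 < l → ∑' i, c i * d i ^ l = 0) ∨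
      ∀ l : ℕ, 0 < l → ∑' i, c' i * d' i ^ l = 0 := by
  have hcon {t : ℝ} (ht : 0 ≤ t) (K : ℝ) : ContinuousOn (fun x : ℝ => x ^ t) (Set.Icc 0 K) :=
    (Real.continuous_rpow_const ht).continuousOn
  have hI (i : ι) : d i ∈ Set.Icc 0 M := Set.Ioc_subset_Icc_self (hd i)
  have hI' (i : κ) : d' i ∈ Set.Icc 0 M := Set.Ioc_subset_Icc_self (hd' i)
  have hprod {h : ℝ → ℝ} (hh : ContinuousOn h (Set.Icc 0 M)) :
      (∑' i, c i * h (d i)) * ∑' i, c' i * h (d' i) =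
        ∑' z : ι × κ, c z.1 * c' z.2 * (h (d z.1) * h (d' z.2)) := by
    rw [tsum_mul_tsum_of_summable_norm (summable_mul_comp hc hI hh).norm
      (summable_mul_comp hc' hI' hh).norm]
    exact tsum_congr fun z => by ring
  have hzero {t : ℝ} (ht : 0 < t) : (∑' i, c i * d i ^ t) * ∑' i, c' i * d' i ^ t = 0 := by
    rw [hprod (hcon ht.le M)]
    -- The multiplicative convolution: masses `c i * c' k` at the points `d i * d' k` in `[0, M *
    -- M]`.
    have := tsum_mul_comp_eq_zero_of_moments (c := fun z : ι × κ => c z.1 * c' z.2)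
      (d := fun z => d z.1 * d' z.2) (M := M * M) (summable_mul_of_summable_norm hc.norm hc'.norm)
      (fun z => ⟨mul_nonneg (hI _).1 (hI' _).1,
        mul_le_mul (hI _).2 (hI' _).2 (hI' _).1 ((hI z.1).1.trans (hI z.1).2)⟩)
      (fun l => ?_) (hcon ht.le (M * M))
    · rw [← this]
      exact tsum_congr fun z => by rw [Real.mul_rpow (hI _).1 (hI' _).1]
    · rw [← hmom l, hprod (h := fun x => x ^ l) (by fun_prop)]
      exact tsum_congr fun z => by rw [mul_pow]
  have han : AnalyticOnNhd ℝ (fun s : ℝ => ∑' i, c i * d i ^ s) (Set.Ioi 0) :=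
    fun t ht => analyticAt_tsum_mul_rpow hc hd ht
  have han' : AnalyticOnNhd ℝ (fun s : ℝ => ∑' i, c' i * d' i ^ s) (Set.Ioi 0) :=
    fun t ht => analyticAt_tsum_mul_rpow hc' hd' ht
  refine (AnalyticOnNhd.eq_zero_or_eq_zero_of_mul_eq_zero han han' (fun t ht => hzero ht)
    isPreconnected_Ioi).imp (fun h l hl => ?_) (fun h l hl => ?_) <;>
  · have := h l (Set.mem_Ioi.mpr (by exact_mod_cast hl))
    simpa [Real.rpow_natCast] using this

open Classical in
theorem tsum_ite_eq_zero_of_pos_moments (hc : Summable c) (hd : ∀ i, d i ∈ Set.Ioc 0 M)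
    (hmom : ∀ l : ℕ, 0 < l → ∑' i, c i * d i ^ l = 0) (μ : ℝ) :
    ∑' i, (if d i = μ then c i else 0) = 0 := by
  have hI (i : ι) : d i ∈ Set.Icc 0 M := Set.Ioc_subset_Icc_self (hd i)
  -- The moment of order zero is not available, so the weights absorb one factor `d i`; it is
  -- divided out at the end, as `μ ≠ 0`.
  have h1 := tsum_ite_eq_zero_of_moments (c := fun i => c i * d i)
    (summable_mul_comp hc hI (h := fun x => x) continuousOn_id) hI
    (fun l => by rw [← hmom (l + 1) l.succ_pos]; exact tsum_congr fun i => by ring) μ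
  rcases eq_or_ne μ 0 with rfl | hμ
  · simp [(hd _).1.ne']
  · have h2 : ∑' i, (if d i = μ then c i * d i else 0) =
        (∑' i, (if d i = μ then c i else 0)) * μ := by
      rw [← tsum_mul_right]
      refine tsum_congr fun i => ?_
      split_ifs with hi
      · rw [hi]
      · rw [zero_mul]
    rw [h2] at h1
    exact (mul_eq_zero.mp h1).resolve_right hμ

end DiscreteMoments

/-! ### Finitely many nodes and annihilating polynomials. -/

open Classical in
theorem tsum_ite_eq_zero_of_moments_of_finite {ι : Type*} {c : ι → ℝ} {d : ι → ℝ}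
    (hc : Summable c) (S : Finset ℝ) (hpos : ∀ μ ∈ S, 0 < μ) (hS : ∀ i, c i ≠ 0 → d i ∈ S)
    (L : Finset ℕ) (hcard : S.card ≤ L.card) (hmom : ∀ l ∈ L, ∑' i, c i * d i ^ l = 0) (μ : ℝ) :
    ∑' i, (if d i = μ then c i else 0) = 0 := by
  have hsum (ν : ℝ) : Summable fun i => if d i = ν then c i else 0 := hc.indicator {i | d i = ν}
  have hexp (l : ℕ) : ∑' i, c i * d i ^ l =
      ∑ ν ∈ S, (∑' i, (if d i = ν then c i else 0)) * ν ^ l := by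
    simp_rw [← tsum_mul_right]
    rw [← Summable.tsum_finsetSum fun ν _ => (hsum ν).mul_right _]
    refine tsum_congr fun i => ?_
    by_cases hi : c i = 0
    · simp [hi]
    · rw [Finset.sum_eq_single_of_mem (d i) (hS i hi)]
      · simp
      · intro ν _ hν
        simp [hν.symm]
  by_cases hμ : μ ∈ S
  · exact eq_zero_of_sum_mul_pow_eq_zero S hpos L hcard _
      (fun l hl => (hexp l).symm.trans (hmom l hl)) μ hμ
  · refine (tsum_congr fun i => ?_).trans tsum_zero
    split_ifs with hi
    · by_contra hci
      exact hμ (hi ▸ hS i hci)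
    · rfl

theorem exists_polynomial_of_annihilatorDegree_eq {E : Type*} [NormedAddCommGroup E]
    [InnerProductSpace ℝ E] {T : E →L[ℝ] E} {x : E} {r : ℕ} (h : annihilatorDegree T x = r) :
    ∃ p : Polynomial ℝ, p ≠ 0 ∧ p.natDegree ≤ r ∧ Polynomial.aeval T p x = 0 := by
  -- A strict bound on the infimum yields a witness without showing that the infimum is attained.
  have hlt : annihilatorDegree T x < ((r + 1 : ℕ) : ℕ∞) := by
    rw [h]
    exact_mod_cast r.lt_succ_self
  simp only [annihilatorDegree, iInf_lt_iff] at hlt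
  obtain ⟨p, ⟨hm, hp⟩, hlt⟩ := hlt
  exact ⟨p, hm.ne_zero, Nat.lt_succ_iff.mp (by exact_mod_cast hlt), hp⟩

/-! ### Diagonal operators on `ℓ²(ℕ)` and their spectral projections. -/

section Diagonal

variable {D : RealEllTwo →L[ℝ] RealEllTwo} {d : ℕ → ℝ} {M : ℝ}

theorem diagonal_pow_apply (hD : ∀ (x : RealEllTwo) (n : ℕ), D x n = d n * x n) (l : ℕ)
    (x : RealEllTwo) (n : ℕ) : (D ^ l) x n = d n ^ l * x n := by
  induction l generalizing x with
  | zero => simp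
  | succ l ih => rw [pow_succ, mul_apply_eq_comp, ih, hD, pow_succ, mul_assoc]

theorem diagonal_aeval_apply (hD : ∀ (x : RealEllTwo) (n : ℕ), D x n = d n * x n)
    (p : Polynomial ℝ) (x : RealEllTwo) (n : ℕ) :
    Polynomial.aeval D p x n = p.eval (d n) * x n := by
  induction p using Polynomial.induction_on' with
  | add p q hp hq => simp [add_mul, hp, hq]
  | monomial l a =>
    rw [Polynomial.aeval_monomial, Algebra.algebraMap_eq_smul_one, smul_one_mul,
      Polynomial.eval_monomial, mul_assoc, ← diagonal_pow_apply hD]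
    rfl

theorem diagonal_inner_pow (hD : ∀ (x : RealEllTwo) (n : ℕ), D x n = d n * x n) (l : ℕ)
    (x ψ : RealEllTwo) : inner ℝ ((D ^ l) x) ψ = ∑' n, x n * ψ n * d n ^ l := by
  rw [lp.inner_eq_tsum]
  refine tsum_congr fun n => ?_
  rw [diagonal_pow_apply hD]
  simp
  ring

theorem summable_mul_ellTwo (x ψ : RealEllTwo) : Summable fun n => x n * ψ n := by
  refine (lp.summable_inner x ψ).congr fun n => ?_
  simp [mul_comm]

theorem diagonal_apply_single (hD : ∀ (x : RealEllTwo) (n : ℕ), D x n = d n * x n) (n : ℕ) :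
    D (lp.single 2 n (1 : ℝ)) = d n • lp.single 2 n (1 : ℝ) := by
  ext m
  rw [hD]
  rcases eq_or_ne m n with rfl | hm
  · simp
  · simp [hm]

-- If `d n = μ`, the basis vector at `n` is an eigenvector, hence orthogonal to `ψ - P ψ`. Otherwise
-- the eigenvalue equation of `P ψ` at coordinate `n` forces zero.
open Classical in
theorem spectralProj_diagonal_apply (hD : ∀ (x : RealEllTwo) (n : ℕ), D x n = d n * x n)
    (μ : eigenvalueSet D) (ψ : RealEllTwo) (n : ℕ) :
    spectralProj D μ ψ n = if d n = μ then ψ n else 0 := by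
  split_ifs with hn
  · have h1 : (lp.single 2 n (1 : ℝ) : RealEllTwo) ∈ eigenKer D μ := by
      rw [mem_eigenKer, diagonal_apply_single hD, hn]
    have h2 := (eigenKer D (μ : ℝ)).sub_starProjection_mem_orthogonal ψ
    have h3 := h2 _ h1
    rw [lp.inner_single_left] at h3
    simp only [lp.coeFn_sub, Pi.sub_apply] at h3
    have h4 : ψ n - spectralProj D μ ψ n = 0 := by
      simpa [spectralProj] using h3
    linarith
  · have h1 : spectralProj D μ ψ ∈ eigenKer D μ := Submodule.starProjection_apply_mem _ _
    rw [mem_eigenKer] at h1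
    have h2 : d n * spectralProj D μ ψ n = μ * spectralProj D μ ψ n := by
      rw [← hD, h1]
      simp
    by_contra h3
    exact hn (mul_right_cancel₀ h3 h2)

open Classical in
theorem inner_spectralProj_diagonal (hD : ∀ (x : RealEllTwo) (n : ℕ), D x n = d n * x n)
    (μ : eigenvalueSet D) (z ψ : RealEllTwo) :
    inner ℝ z (spectralProj D μ ψ) = ∑' n, (if d n = μ then z n * ψ n else 0) := by
  rw [lp.inner_eq_tsum]
  refine tsum_congr fun n => ?_
  rw [spectralProj_diagonal_apply hD]
  split_ifs <;> simp [mul_comm]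

open Classical in
/-- Phaseless time samples of a positive diagonal operator determine the spectral pairings of
two vectors with the sampling vector up to a common sign. -/
theorem inner_spectralProj_sub_or_add_eq_zero
    (hD : ∀ (x : RealEllTwo) (n : ℕ), D x n = d n * x n) (hd : ∀ n, d n ∈ Set.Ioc 0 M)
    (x y ψ : RealEllTwo)
    (h : ∀ l : ℕ, (l : ℕ∞) < numTimeLevels D ψ →
      |inner ℝ ((D ^ l) x) ψ| = |inner ℝ ((D ^ l) y) ψ|) :
    (∀ μ, inner ℝ (x - y) (spectralProj D μ ψ) = 0) ∨
      ∀ μ, inner ℝ (x + y) (spectralProj D μ ψ) = 0 := by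
  simp only [inner_spectralProj_diagonal hD]
  have hs := summable_mul_ellTwo (x - y) ψ
  have ha := summable_mul_ellTwo (x + y) ψ
  have hor (l : ℕ) (hl : (l : ℕ∞) < numTimeLevels D ψ) :
      ∑' n, (x - y) n * ψ n * d n ^ l = 0 ∨ ∑' n, (x + y) n * ψ n * d n ^ l = 0 := by
    rw [← diagonal_inner_pow hD, ← diagonal_inner_pow hD, map_sub, map_add, inner_sub_left,
      inner_add_left, sub_eq_zero, add_eq_zero_iff_eq_neg]
    exact abs_eq_abs.mp (h l hl)
  cases hr : annihilatorDegree D ψ with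
  | top =>
    have hT : numTimeLevels D ψ = ⊤ := by simp [numTimeLevels, hr]
    refine (moments_eq_zero_or_of_mul_eq_zero hs hd ha hd fun l => ?_).imp (fun hm μ => ?_)
      fun hm μ => ?_
    · exact mul_eq_zero.mpr (hor l (hT ▸ ENat.natCast_lt_top l))
    · exact tsum_ite_eq_zero_of_pos_moments hs hd hm _
    · exact tsum_ite_eq_zero_of_pos_moments ha hd hm _
  | coe r =>
    have hT : numTimeLevels D ψ = ((2 * r - 1 : ℕ) : ℕ∞) := by
      simp [numTimeLevels, hr]
    obtain ⟨p, hp0, hpr, hp⟩ := exists_polynomial_of_annihilatorDegree_eq hr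
    -- `p(D) ψ = 0` forces `p (d n) = 0` wherever `ψ n ≠ 0`, so `S` contains every node carrying
    -- mass.
    let S : Finset ℝ := p.roots.toFinset.filter (0 < ·)
    have hpos : ∀ μ ∈ S, 0 < μ := fun μ hμ => (Finset.mem_filter.mp hμ).2
    have hS (n : ℕ) (hn : ψ n ≠ 0) : d n ∈ S := by
      have h1 := diagonal_aeval_apply hD p ψ n
      rw [hp] at h1
      have h2 : p.eval (d n) = 0 := (mul_eq_zero.mp h1.symm).resolve_right hn
      simp [S, hp0, h2, (hd n).1]
    have hcard : S.card ≤ r :=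
      (Finset.card_filter_le _ _).trans ((Multiset.toFinset_card_le _).trans
        ((Polynomial.card_roots' p).trans hpr))
    let L₁ := (Finset.range (2 * r - 1)).filter fun l => ∑' n, (x - y) n * ψ n * d n ^ l = 0
    let L₂ := (Finset.range (2 * r - 1)).filter fun l => ∑' n, (x + y) n * ψ n * d n ^ l = 0
    have hL : Finset.range (2 * r - 1) ⊆ L₁ ∪ L₂ := by
      intro l hl
      have := hor l (by rw [hT]; exact_mod_cast Finset.mem_range.mp hl)
      exact Finset.mem_union.mpr (this.imp (fun h0 => Finset.mem_filter.mpr ⟨hl, h0⟩)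
        fun h0 => Finset.mem_filter.mpr ⟨hl, h0⟩)
    have hL' := (Finset.card_le_card hL).trans (Finset.card_union_le _ _)
    rw [Finset.card_range] at hL'
    -- Pigeonhole: two sets covering `2r - 1` levels cannot both have fewer than `r` elements. For
    -- `r = 0` the set `S` is empty.
    rcases (by omega : S.card ≤ L₁.card ∨ S.card ≤ L₂.card) with hc | hc
    · exact Or.inl fun μ => tsum_ite_eq_zero_of_moments_of_finite hs S hpos
        (fun n hn => hS n (right_ne_zero_of_mul hn)) L₁ hc
        (fun l hl => (Finset.mem_filter.mp hl).2) _
    · exact Or.inr fun μ => tsum_ite_eq_zero_of_moments_of_finite ha S hpos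
        (fun n hn => hS n (right_ne_zero_of_mul hn)) L₂ hc
        (fun l hl => (Finset.mem_filter.mp hl).2) _

/-- Each basis vector is an eigenvector, so it lies in the closed span for its own eigenvalue, to
which `z` is orthogonal; every coordinate of `z` therefore vanishes. -/
theorem eq_zero_of_inner_spectralProj_eq_zero_of_span
    (hD : ∀ (x : RealEllTwo) (n : ℕ), D x n = d n * x n) {ι : Type*} {ψ : ι → RealEllTwo}
    {I : Set ι} {z : RealEllTwo}
    (hI : ∀ μ : eigenvalueSet D,
      (Submodule.span ℝ ((fun i => spectralProj D μ (ψ i)) '' I)).topologicalClosure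
        = LinearMap.range (spectralProj D μ : RealEllTwo →ₗ[ℝ] RealEllTwo))
    (hz : ∀ i ∈ I, ∀ μ, inner ℝ z (spectralProj D μ (ψ i)) = 0) : z = 0 := by
  ext n
  have hne : (lp.single 2 n (1 : ℝ) : RealEllTwo) ≠ 0 := fun h0 => by
    simpa using congrArg (fun w : RealEllTwo => w n) h0
  have he := diagonal_apply_single hD n
  let μ : eigenvalueSet D := ⟨d n, _, hne, he⟩
  have hmem : (lp.single 2 n (1 : ℝ) : RealEllTwo) ∈
      (Submodule.span ℝ ((fun i => spectralProj D μ (ψ i)) '' I)).topologicalClosure := by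
    rw [hI μ]
    exact ⟨_, Submodule.starProjection_eq_self_iff.mpr ((mem_eigenKer _ _ _).mpr he)⟩
  have hle : (Submodule.span ℝ ((fun i => spectralProj D μ (ψ i)) '' I)).topologicalClosure ≤
      (ℝ ∙ z)ᗮ := by
    refine Submodule.topologicalClosure_minimal _ (Submodule.span_le.mpr ?_)
      (Submodule.isClosed_orthogonal _)
    rintro _ ⟨i, hi, rfl⟩
    exact Submodule.mem_orthogonal_singleton_iff_inner_right.mpr (hz i hi μ)
  have := Submodule.mem_orthogonal_singleton_iff_inner_right.mp (hle hmem)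
  rw [lp.inner_single_right] at this
  simpa using this

/-- Phaseless reconstruction from the time samples of a positive diagonal operator. -/
theorem eq_or_eq_neg_of_diagonal_samples
    (hD : ∀ (x : RealEllTwo) (n : ℕ), D x n = d n * x n) (hd : ∀ n, d n ∈ Set.Ioc 0 M)
    {ι : Type*} {ψ : ι → RealEllTwo} (hΨ : LocallyComplementary (spectralProj D) ψ)
    {x y : RealEllTwo}
    (h : ∀ (i : ι) (l : ℕ), (l : ℕ∞) < numTimeLevels D (ψ i) →
      |inner ℝ ((D ^ l) x) (ψ i)| = |inner ℝ ((D ^ l) y) (ψ i)|) :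
    x = y ∨ x = -y := by
  -- The indices for which the minus sign works; on the complement the plus sign must work.
  let I : Set ι := {i | ∀ μ, inner ℝ (x - y) (spectralProj D μ (ψ i)) = 0}
  rcases hΨ I Iᶜ (Set.union_compl_self I) disjoint_compl_right with hI | hI
  · exact Or.inl (sub_eq_zero.mp
      (eq_zero_of_inner_spectralProj_eq_zero_of_span hD hI fun i hi => hi))
  · exact Or.inr (eq_neg_of_add_eq_zero_left
      (eq_zero_of_inner_spectralProj_eq_zero_of_span hD hI fun i hi =>
        (inner_spectralProj_sub_or_add_eq_zero hD hd x y (ψ i) (h i)).resolve_left hi))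

end Diagonal

/-! ### Transfer to `A` by unitary conjugation. -/

theorem mainTheorem5
    {H : Type*} [NormedAddCommGroup H] [InnerProductSpace ℝ H] [CompleteSpace H]
    [TopologicalSpace.SeparableSpace H]
    (A : H →L[ℝ] H) (hA : StrictlyPositiveOperator A)
    (U : H ≃ₗᵢ[ℝ] RealEllTwo)
    (D : RealEllTwo →L[ℝ] RealEllTwo) (hD : IsDiagonalOperator D)
    (hAD : ContinuousLinearMap.adjoint A =
      ContinuousLinearMap.adjoint (U.toContinuousLinearEquiv : H →L[ℝ] RealEllTwo) ∘L D ∘L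
        (U.toContinuousLinearEquiv : H →L[ℝ] RealEllTwo))
    {ι : Type*} (φ : ι → H)
    (hΨ : LocallyComplementary (spectralProj D) (fun i => U (φ i))) :
    DoesPhaselessReconstruction ℝ
      {v : H | ∃ (i : ι) (l : ℕ), (l : ℕ∞) < numTimeLevels D (U (φ i)) ∧
        v = (ContinuousLinearMap.adjoint A ^ l) (φ i)} ∧
    ∀ f g : H,
      (∀ (i : ι) (l : ℕ), (l : ℕ∞) < numTimeLevels D (U (φ i)) →
        |inner ℝ ((A ^ l) f) (φ i)| = |inner ℝ ((A ^ l) g) (φ i)|) →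
      f = g ∨ f = -g := by
  obtain ⟨d, hd⟩ := hD
  have hA' : ContinuousLinearMap.adjoint A = A := hA.1.isSelfAdjoint.adjoint_eq
  have hUA (v : H) : U (A v) = D (U v) := by
    rw [← hA', hAD]
    simp [LinearIsometryEquiv.adjoint_eq_symm]
  have hUpow (l : ℕ) (v : H) : U ((A ^ l) v) = (D ^ l) (U v) := by
    induction l generalizing v with
    | zero => simp
    | succ l ih =>
      rw [pow_succ, pow_succ, mul_apply_eq_comp, mul_apply_eq_comp, ih,
        hUA]
  have hdmem (n : ℕ) : d n ∈ Set.Ioc 0 ‖D‖ := by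
    let e : RealEllTwo := lp.single 2 n (1 : ℝ)
    have he : D e = d n • e := diagonal_apply_single hd n
    have hnorm : ‖e‖ = 1 := by simp [e, lp.norm_single]
    constructor
    · have hne : U.symm e ≠ 0 := fun h0 => by
        simp [(map_eq_zero_iff _ U.symm.injective).mp h0] at hnorm
      -- Strict positivity tested on the preimage of a basis vector gives `0 < d n`.
      have h1 := hA.2 _ hne
      rw [← U.inner_map_map, hUA, U.apply_symm_apply, he, real_inner_smul_left,
        real_inner_self_eq_norm_sq, hnorm] at h1
      simpa using h1
    · have h1 := D.le_opNorm e
      rw [he, norm_smul, hnorm, mul_one, mul_one] at h1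
      exact (le_abs_self _).trans h1
  have huniq (f g : H)
      (h : ∀ (i : ι) (l : ℕ), (l : ℕ∞) < numTimeLevels D (U (φ i)) →
        |inner ℝ ((A ^ l) f) (φ i)| = |inner ℝ ((A ^ l) g) (φ i)|) : f = g ∨ f = -g := by
    have h1 := eq_or_eq_neg_of_diagonal_samples hd hdmem hΨ (x := U f) (y := U g)
      fun i l hl => by
        rw [← hUpow, ← hUpow, U.inner_map_map, U.inner_map_map]
        exact h i l hl
    rw [← map_neg] at h1
    exact h1.imp (fun h => U.injective h) fun h => U.injective h
  refine ⟨fun f g h => ?_, huniq⟩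
  -- Self-adjointness moves the powers across, so both conclusions concern the same measurements.
  have hpow (l : ℕ) (v w : H) : inner ℝ v ((A ^ l) w) = inner ℝ ((A ^ l) v) w :=
    ((hA.1.isSelfAdjoint.pow l).isSymmetric v w).symm
  rcases huniq f g fun i l hl => by
    have := h _ ⟨i, l, hl, rfl⟩
    rwa [hA', hpow, hpow, Real.norm_eq_abs, Real.norm_eq_abs] at this with rfl | rfl
  · exact ⟨1, by simp⟩
  · exact ⟨-1, by simp⟩
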